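/- Let $S_0$ be the group of those permutations of $\mathbb Z$ that fix all but finitely many integers, and let $A_0 \subset S_0$ be the subgroup of even permutations. Let $\mathbb Z$ act on $S_0$ by the shift, that is, $n \in \mathbb Z$ sends $\sigma \in S_0$ to the permutation $x \mapsto \sigma(x-n)+n$, and let $\Gamma := \mathbb Z \ltimes S_0$ be the corresponding semidirect product, with $S_0$ (and hence $A_0$) regarded as a subgroup of $\Gamma$. Then every finite-dimensional unitary representation $\rho$ of $\Gamma$ (on a complex inner product space) is trivial on $A_0$, i.e. $\rho(\gamma) = \mathbb 1$ for all $\gamma \in A_0$. -/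

import Mathlib

/-- The group `S₀` of the permutations of `ℤ` that fix all but finitely many integers. -/
def finitaryPerm : Subgroup (Equiv.Perm ℤ) where
  carrier := {σ | {x : ℤ | σ x ≠ x}.Finite}
  one_mem' := by simp
  mul_mem' := by
    intro σ τ hσ hτ
    refine (Set.Finite.union hσ hτ).subset fun x hx => ?_
    by_contra h
    simp only [Set.mem_union, Set.mem_ofPred_eq, not_or, not_not] at h
    exact hx (by rw [Equiv.Perm.mul_apply, h.2, h.1])
  inv_mem' := by
    intro σ hσ
    refine Set.Finite.subset hσ fun x hx h => hx ?_
    exact Equiv.Perm.inv_eq_iff_eq.2 h.symm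

theorem mem_finitaryPerm {σ : Equiv.Perm ℤ} :
    σ ∈ finitaryPerm ↔ {x : ℤ | σ x ≠ x}.Finite := Iff.rfl

instance finitaryPerm_normal : finitaryPerm.Normal where
  conj_mem := by
    intro σ hσ τ
    refine (Set.Finite.image τ (mem_finitaryPerm.1 hσ)).subset fun x hx => ?_
    refine ⟨τ⁻¹ x, fun h => hx ?_, by simp⟩
    rw [Equiv.Perm.mul_apply, Equiv.Perm.mul_apply, h]
    simp

/-- The subgroup `A₀` of the even permutations in `S₀`: the products of an even number of
transpositions of `ℤ`. -/
def evenFinitaryPerm : Subgroup finitaryPerm where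
  carrier := {σ | ∃ l : List (Equiv.Perm ℤ),
    (∀ g ∈ l, g.IsSwap) ∧ Even l.length ∧ l.prod = (σ : Equiv.Perm ℤ)}
  one_mem' := ⟨[], by simp⟩
  mul_mem' := by
    rintro σ τ ⟨l, hl, hle, hlσ⟩ ⟨m, hm, hme, hmτ⟩
    refine ⟨l ++ m, fun g hg => ?_, ?_, ?_⟩
    · exact (List.mem_append.1 hg).elim (hl g) (hm g)
    · rw [List.length_append]
      exact hle.add hme
    · rw [List.prod_append, hlσ, hmτ]
      rfl
  inv_mem' := by
    rintro σ ⟨l, hl, hle, hlσ⟩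
    refine ⟨(l.map fun g => g⁻¹).reverse, fun g hg => ?_, by simpa using hle, ?_⟩
    · obtain ⟨h, hh, rfl⟩ := List.mem_map.1 (List.mem_reverse.1 hg)
      obtain ⟨x, y, hxy, rfl⟩ := hl h hh
      exact ⟨x, y, hxy, Equiv.swap_inv x y⟩
    · rw [← List.prod_inv_reverse, hlσ]
      rfl

/-- The shift action of `ℤ` on `S₀`: `n` acts as conjugation by the `n`-th power of the shift
`x ↦ x + 1`, so that it sends `σ` to `x ↦ σ (x - n) + n`. The group `ℤ` is written multiplicatively. -/
def shiftAction : Multiplicative ℤ →* MulAut finitaryPerm :=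
  MulAut.conjNormal.comp (zpowersHom (Equiv.Perm ℤ) (Equiv.addRight (1 : ℤ)))

/-- The group `Γ = ℤ ⋉ S₀`. -/
abbrev ShiftFinitaryGroup : Type := finitaryPerm ⋊[shiftAction] Multiplicative ℤ

/-- The subgroup `A₀`, regarded as a subgroup of `Γ = ℤ ⋉ S₀`. -/
def evenSubgroup : Subgroup ShiftFinitaryGroup :=
  evenFinitaryPerm.map SemidirectProduct.inl

/-! The disjoint transpositions (2k, 2k+1) act by commuting unitary involutions. In finite dimension
the unitaries lie in a compact ball, so two of these are at distance less than 2. Their quotient is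
again an involution, and an involution that close to 1 equals 1, so two disjoint transpositions have
the same image. Conjugation spreads this coincidence (`map_finSwap_eq`): all transpositions share
one image, of square 1, which kills every even product. -/

theorem swap_mem_finitaryPerm (x y : ℤ) : Equiv.swap x y ∈ finitaryPerm := by
  refine mem_finitaryPerm.2 ((Set.toFinite {x, y}).subset fun z hz => ?_)
  by_contra h
  simp only [Set.mem_insert_iff, Set.mem_singleton_iff, not_or] at h
  exact hz (Equiv.swap_apply_of_ne_of_ne h.1 h.2)

/-- The transposition of `x` and `y` as an element of `S₀`. -/
def finSwap (x y : ℤ) : finitaryPerm := ⟨Equiv.swap x y, swap_mem_finitaryPerm x y⟩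

theorem finSwap_mul_self (x y : ℤ) : finSwap x y * finSwap x y = 1 :=
  Subtype.ext (Equiv.swap_mul_self x y)

theorem finSwap_conj (u v x y : ℤ) :
    finSwap u v * finSwap x y * finSwap u v =
      finSwap (Equiv.swap u v x) (Equiv.swap u v y) := by
  apply Subtype.ext
  have h := Equiv.mul_swap_eq_swap_mul (Equiv.swap u v) x y
  change Equiv.swap u v * Equiv.swap x y * Equiv.swap u v = _
  rw [h, mul_assoc, Equiv.swap_mul_self, mul_one]
  rfl

section Swaps

variable {G : Type*} [Group G] (φ : finitaryPerm →* G)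

/-- Conjugation by a transposition disjoint from (c d) leaves (c d) unchanged. -/
theorem map_finSwap_conj {c d u v x y : ℤ} (h : φ (finSwap x y) = φ (finSwap c d))
    (hcu : c ≠ u) (hcv : c ≠ v) (hdu : d ≠ u) (hdv : d ≠ v) :
    φ (finSwap (Equiv.swap u v x) (Equiv.swap u v y)) = φ (finSwap c d) := by
  rw [← finSwap_conj, map_mul, map_mul, h, ← map_mul, ← map_mul, finSwap_conj,
    Equiv.swap_apply_of_ne_of_ne hcu hcv, Equiv.swap_apply_of_ne_of_ne hdu hdv]

/-- If two disjoint transpositions have the same image, then so do all those that are disjoint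
from the second one. -/
theorem map_finSwap_eq_of_disjoint {a b c d x y : ℤ} (h : φ (finSwap a b) = φ (finSwap c d))
    (hab : a ≠ b) (hca : c ≠ a) (hcb : c ≠ b) (hda : d ≠ a) (hdb : d ≠ b)
    (hxy : x ≠ y) (hcx : c ≠ x) (hcy : c ≠ y) (hdx : d ≠ x) (hdy : d ≠ y) :
    φ (finSwap x y) = φ (finSwap c d) := by
  -- Move a to x. If b = x, this sends b to a, so the second move starts from `Equiv.swap x a b`.
  have h₁ := map_finSwap_conj φ (u := x) (v := a) h hcx hca hdx hda
  rw [Equiv.swap_apply_right] at h₁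
  have hb : Equiv.swap x a b ≠ x := by
    rw [Ne, Equiv.swap_apply_eq_iff, Equiv.swap_apply_left]
    exact hab.symm
  have hcb' : c ≠ Equiv.swap x a b := by
    rw [Equiv.swap_apply_def]; split_ifs <;> assumption
  have hdb' : d ≠ Equiv.swap x a b := by
    rw [Equiv.swap_apply_def]; split_ifs <;> assumption
  have h₂ := map_finSwap_conj φ (u := Equiv.swap x a b) (v := y) h₁ hcb' hcy hdb' hdy
  rwa [Equiv.swap_apply_left, Equiv.swap_apply_of_ne_of_ne hb.symm hxy] at h₂

/-- If two disjoint transpositions have the same image, then all transpositions do. -/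
theorem map_finSwap_eq {a b c d x y : ℤ} (h : φ (finSwap a b) = φ (finSwap c d))
    (hab : a ≠ b) (hca : c ≠ a) (hcb : c ≠ b) (hda : d ≠ a) (hdb : d ≠ b) (hxy : x ≠ y) :
    φ (finSwap x y) = φ (finSwap c d) := by
  obtain ⟨n, hn⟩ := (Set.toFinite ({c, d, x, y} : Set ℤ)).bddAbove
  have hcn : c ≤ n := hn (by simp)
  have hdn : d ≤ n := hn (by simp)
  have hxn : x ≤ n := hn (by simp)
  have hyn : y ≤ n := hn (by simp)
  -- (x y) may meet (c d), so the reference pair is replaced by fresh transpositions beyond all four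
  -- points.
  have h₁ := map_finSwap_eq_of_disjoint φ (x := n + 1) (y := n + 2) h hab hca hcb hda hdb
    (by omega) (by omega) (by omega) (by omega) (by omega)
  have h₂ := map_finSwap_eq_of_disjoint φ (x := n + 3) (y := n + 4) h hab hca hcb hda hdb
    (by omega) (by omega) (by omega) (by omega) (by omega)
  rw [← h₂]
  exact map_finSwap_eq_of_disjoint φ (h₁.trans h₂.symm) (by omega) (by omega) (by omega)
    (by omega) (by omega) hxy (by omega) (by omega) (by omega) (by omega)

theorem map_eq_pow_of_prod_swaps {C : G} (hC : ∀ x y : ℤ, x ≠ y → φ (finSwap x y) = C)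
    (l : List (Equiv.Perm ℤ)) (hl : ∀ g ∈ l, g.IsSwap) (σ : finitaryPerm)
    (hσ : l.prod = (σ : Equiv.Perm ℤ)) : φ σ = C ^ l.length := by
  induction l generalizing σ with
  | nil =>
    have : σ = 1 := Subtype.ext hσ.symm
    simp [this]
  | cons g l ih =>
    obtain ⟨x, y, hxy, rfl⟩ := hl g (by simp)
    have hl' := ih (fun g hg => hl g (by simp [hg])) (finSwap x y * σ) (by
      rw [Subgroup.coe_mul, ← hσ, List.prod_cons, ← mul_assoc]
      change _ = Equiv.swap x y * Equiv.swap x y * _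
      rw [Equiv.swap_mul_self, one_mul])
    rw [List.length_cons, pow_succ', ← hl', ← hC x y hxy, ← map_mul, ← mul_assoc,
      finSwap_mul_self, one_mul]

/-- If two disjoint transpositions have the same image, then the homomorphism is trivial on the
even permutations. -/
theorem map_eq_one_of_mem_evenFinitaryPerm {a b c d : ℤ}
    (h : φ (finSwap a b) = φ (finSwap c d))
    (hab : a ≠ b) (hca : c ≠ a) (hcb : c ≠ b) (hda : d ≠ a) (hdb : d ≠ b)
    {σ : finitaryPerm} (hσ : σ ∈ evenFinitaryPerm) : φ σ = 1 := by
  obtain ⟨l, hl, ⟨m, hm⟩, hlσ⟩ := hσ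
  rw [map_eq_pow_of_prod_swaps φ (fun x y hxy => map_finSwap_eq φ h hab hca hcb hda hdb hxy)
    l hl σ hlσ, hm, ← two_mul, pow_mul, pow_two, ← map_mul, finSwap_mul_self, map_one, one_pow]

end Swaps

/-- An involution at distance less than `2` from the identity is the identity. -/
theorem eq_one_of_mul_self_of_norm_sub_one_lt {A : Type*} [NormedRing A] [NormedAlgebra ℂ A]
    {U : A} (hU : U * U = 1) (h : ‖U - 1‖ < 2) : U = 1 := by
  -- T = U - 1 satisfies T² = -2T, so 2‖T‖ ≤ ‖T‖², which forces T = 0 when ‖T‖ < 2.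
  have hT : (U - 1) * (U - 1) = -((2 : ℂ) • (U - 1)) := by
    rw [two_smul, sub_mul, mul_sub, hU]
    simp only [mul_one, one_mul]
    abel
  have h₁ : 2 * ‖U - 1‖ ≤ ‖U - 1‖ * ‖U - 1‖ := by
    calc 2 * ‖U - 1‖ = ‖(U - 1) * (U - 1)‖ := by
          rw [hT, norm_neg, norm_smul]; simp
      _ ≤ _ := norm_mul_le _ _
  have h₂ : ‖U - 1‖ = 0 := by nlinarith [norm_nonneg (U - 1)]
  exact sub_eq_zero.1 (norm_eq_zero.1 h₂)

/-- A sequence of unitary operators on a finite-dimensional space has two terms that are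
arbitrarily close to each other. -/
theorem exists_lt_norm_inv_mul_sub_one_lt {H : Type*} [NormedAddCommGroup H]
    [InnerProductSpace ℂ H] [FiniteDimensional ℂ H] (u : ℕ → (H ≃ₗᵢ[ℂ] H)) {ε : ℝ} (hε : 0 < ε) :
    ∃ k l, k < l ∧
      ‖((((u k)⁻¹ * u l : H ≃ₗᵢ[ℂ] H) : H ≃L[ℂ] H) : H →L[ℂ] H) - 1‖ < ε := by
  have : ProperSpace (H →L[ℂ] H) := FiniteDimensional.proper ℂ _
  let T : ℕ → (H →L[ℂ] H) := fun k => ((u k : H ≃L[ℂ] H) : H →L[ℂ] H)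
  have hT : ∀ k, T k ∈ Metric.closedBall (0 : H →L[ℂ] H) 1 := fun k => by
    rw [mem_closedBall_zero_iff]
    exact ContinuousLinearMap.opNorm_le_bound _ zero_le_one fun x => by simp [T]
  obtain ⟨_, -, φ, hφ, hlim⟩ := tendsto_subseq_of_bounded Metric.isBounded_closedBall hT
  -- The operator norm bound below is not strict, hence ε / 2.
  obtain ⟨N, hN⟩ := Metric.cauchySeq_iff.1 hlim.cauchySeq (ε / 2) (half_pos hε)
  refine ⟨φ N, φ (N + 1), hφ N.lt_succ_self, lt_of_le_of_lt ?_ (half_lt_self hε)⟩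
  have hd := (hN (N + 1) (by omega) N le_rfl).le
  rw [dist_eq_norm] at hd
  refine ContinuousLinearMap.opNorm_le_bound _ (half_pos hε).le fun x => ?_
  have hx : ((u (φ N))⁻¹ * u (φ (N + 1))) x - x =
      (u (φ N))⁻¹ (u (φ (N + 1)) x - u (φ N) x) := by
    rw [map_sub]
    exact congrArg _ ((u (φ N)).symm_apply_apply x).symm
  calc _ = ‖((u (φ N))⁻¹ * u (φ (N + 1))) x - x‖ := rfl
    _ = ‖(T (φ (N + 1)) - T (φ N)) x‖ := by
      rw [hx, LinearIsometryEquiv.norm_map]; rfl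
    _ ≤ _ := ContinuousLinearMap.le_of_opNorm_le _ hd x

/-- In a sequence of commuting unitary involutions on a finite-dimensional space, some two terms
are equal. -/
theorem exists_lt_eq_of_commuting_involutions {H : Type*} [NormedAddCommGroup H]
    [InnerProductSpace ℂ H] [FiniteDimensional ℂ H] (u : ℕ → (H ≃ₗᵢ[ℂ] H))
    (hu : ∀ k, u k * u k = 1) (hc : ∀ k l, Commute (u k) (u l)) : ∃ k l, k < l ∧ u k = u l := by
  obtain ⟨k, l, hkl, h⟩ := exists_lt_norm_inv_mul_sub_one_lt u two_pos
  refine ⟨k, l, hkl, ?_⟩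
  -- Commutativity makes the quotient an involution.
  have hg : ((u k)⁻¹ * u l) * ((u k)⁻¹ * u l) = 1 := by
    rw [inv_eq_of_mul_eq_one_left (hu k), mul_assoc, ← mul_assoc (u l), ← (hc k l).eq,
      mul_assoc, hu l, mul_one, hu k]
  have h₁ := eq_one_of_mul_self_of_norm_sub_one_lt
    (U := ((((u k)⁻¹ * u l : H ≃ₗᵢ[ℂ] H) : H ≃L[ℂ] H) : H →L[ℂ] H))
    (by ext x; exact DFunLike.congr_fun hg x) h
  exact inv_mul_eq_one.1 (LinearIsometryEquiv.ext fun x => DFunLike.congr_fun h₁ x)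

theorem commute_finSwap {a b c d : ℤ} (hca : c ≠ a) (hcb : c ≠ b) (hda : d ≠ a) (hdb : d ≠ b) :
    Commute (finSwap a b) (finSwap c d) := by
  have h := finSwap_conj a b c d
  rw [Equiv.swap_apply_of_ne_of_ne hca hcb, Equiv.swap_apply_of_ne_of_ne hda hdb] at h
  calc finSwap a b * finSwap c d
      = finSwap a b * finSwap c d * finSwap a b * finSwap a b := by
        rw [mul_assoc _ (finSwap a b) (finSwap a b), finSwap_mul_self, mul_one]
    _ = finSwap c d * finSwap a b := by rw [h]

/-- A unitary representation of the discrete group `Γ` on the complex inner product space `H` is a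
homomorphism from `Γ` to the group `H ≃ₗᵢ[ℂ] H` of the unitary operators of `H`. -/
theorem proposition8p7 {H : Type*} [NormedAddCommGroup H] [InnerProductSpace ℂ H]
    [FiniteDimensional ℂ H] (ρ : ShiftFinitaryGroup →* (H ≃ₗᵢ[ℂ] H)) :
    ∀ γ ∈ evenSubgroup, ρ γ = 1 := by
  rintro _ ⟨σ, hσ, rfl⟩
  let φ : finitaryPerm →* (H ≃ₗᵢ[ℂ] H) := ρ.comp SemidirectProduct.inl
  obtain ⟨k, l, hkl, h⟩ := exists_lt_eq_of_commuting_involutions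
    (fun k : ℕ => φ (finSwap (2 * k) (2 * k + 1)))
    (fun k => by rw [← map_mul, finSwap_mul_self, map_one])
    (fun k l => by
      rcases eq_or_ne k l with rfl | hkl
      · exact Commute.refl _
      · exact (commute_finSwap (by omega) (by omega) (by omega) (by omega)).map φ)
  exact map_eq_one_of_mem_evenFinitaryPerm φ h (by omega) (by omega) (by omega) (by omega)
    (by omega) hσ
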